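/- Let $I$ be a finite set with standard basis $(\alpha_i)_{i\in I}$ of $\mathbb Z^I$. A Cartan scheme consists of a non-empty set $A$ (of objects), maps $\rho_i:A\to A$ $(i\in I)$ and generalized Cartan matrices $C^a=(c^a_{ij})_{i,j\in I}$ $(a\in A)$ with $\rho_i^2=\mathrm{id}$ and $c^a_{ij}=c^{\rho_i(a)}_{ij}$ for all $a\in A$, $i,j\in I$; put $\sigma_i^a(\alpha_j)=\alpha_j-c^a_{ij}\alpha_i$. Its rank is $|I|$. Its Weyl groupoid has object set $A$ and morphisms generated by the $\sigma_i^a\in\mathrm{Hom}(a,\rho_i(a))$, and the scheme is connected if $\mathrm{Hom}(a,b)\neq\emptyset$ for all $a,b\in A$. Its object change diagram is the undirected multigraph with vertex set $A$ having, for all $i\in I$ and $a\in A$ with $\rho_i(a)\neq a$, exactly one edge labelled $i$ between $a$ and $\rho_i(a)$. (Two vertices joined by exactly two edges count as a cycle, and a single vertex without edges counts as a chain.) A root system of this type is a family of sets $R^a\subset\mathbb Z^I$ $(a\in A)$ such that, with $R^a_+=R^a\cap\mathbb N_0^I$: $R^a=R^a_+\cup -R^a_+$; $R^a\cap\mathbb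 Z\alpha_i=\{\alpha_i,-\alpha_i\}$; $\sigma_i^a(R^a)=R^{\rho_i(a)}$; and, for $i\neq j$, if $m=|R^a\cap(\mathbb N_0\alpha_i+\mathbb N_0\alpha_j)|$ is finite then $(\rho_i\rho_j)^m(a)=a$. It is finite if all $R^a$ are finite, connected if the Cartan scheme is connected, and irreducible if there is no partition of $I$ into non-empty sets $J,K$ with $R^a\subset\mathbb Z^J\cup\mathbb Z^K$ for all $a\in A$. (For finite connected root systems irreducibility is equivalent to indecomposability of all matrices $C^a$.) **Proposition.** For every integer $n\ge 1$: 1. there is a finite connected irreducible root system of rank two, with all $C^a$ indecomposable, with exactly $2n$ objects, whose object change diagram is a cycle, and such that $-(2n+1)$ (that is, $-(|A|+1)$) is an entry of the Cartan matrix $C^a$ for some object $a$; 2. there is a finite connected irreducible root system of rank two, with all $C^a$ indecomposable, with exactly $n$ objects, whose object change diagram is a chain, and such that $-(2n+1)$ (that is, $-(2|A|+1)$) is an entry of the Cartan matrix $C^a$ for some object $a$. -/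

import Mathlib

open scoped Pointwise

/-- A generalized Cartan matrix with integer entries. -/
structure IsGeneralizedCartanMatrix {I : Type*} (M : Matrix I I ℤ) : Prop where
  diag : ∀ i, M i i = 2
  nonpos : ∀ j k, j ≠ k → M j k ≤ 0
  zero_symm : ∀ i j, M i j = 0 → M j i = 0

/-- A generalized Cartan matrix is indecomposable if it is not block diagonal with respect to
a partition of the index set into two non-empty parts. -/
def IsIndecomposableCartanMatrix {I : Type*} (M : Matrix I I ℤ) : Prop :=
  ¬ ∃ J : Set I, J.Nonempty ∧ Jᶜ.Nonempty ∧ ∀ i ∈ J, ∀ j ∈ Jᶜ, M i j = 0 ∧ M j i = 0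

/-- A Cartan scheme `(I, A, (ρ_i), (C^a))`: a non-empty set `A` of objects, an involution
`ρ_i` of `A` for each `i ∈ I`, and a generalized Cartan matrix `C^a` for each object `a`, such
that the `i`-th rows of `C^a` and `C^{ρ_i(a)}` agree. -/
structure CartanScheme (I : Type*) (A : Type*) [Fintype I] [DecidableEq I] [Nonempty I] where
  nonempty_objects : Nonempty A
  ρ : I → A → A
  cartan : A → Matrix I I ℤ
  isGCM : ∀ a, IsGeneralizedCartanMatrix (cartan a)
  ρ_ρ : ∀ i a, ρ i (ρ i a) = a
  row_eq : ∀ a i j, cartan a i j = cartan (ρ i a) i j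

namespace CartanScheme

variable {I A : Type*} [Fintype I] [DecidableEq I] [Nonempty I]

/-- The standard basis vector `α_i` of `ℤ^I`. -/
def simpleRoot (i : I) : I → ℤ := Pi.single i 1

/-- The linear form `α_j ↦ c^a_{ij}` on `ℤ^I`. -/
def rowForm (C : CartanScheme I A) (a : A) (i : I) : (I → ℤ) →ₗ[ℤ] ℤ where
  toFun x := ∑ j, C.cartan a i j * x j
  map_add' x y := by simp [mul_add, Finset.sum_add_distrib]
  map_smul' r x := by simp [Finset.mul_sum, mul_left_comm]

theorem rowForm_simpleRoot (C : CartanScheme I A) (a : A) (i j : I) :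
    C.rowForm a i (simpleRoot j) = C.cartan a i j := by
  simp [rowForm, simpleRoot, Pi.single_apply]

theorem rowForm_simpleRoot_self (C : CartanScheme I A) (a : A) (i : I) :
    C.rowForm a i (simpleRoot i) = 2 := by
  rw [rowForm_simpleRoot, (C.isGCM a).diag]

/-- The automorphism `σ_i^a` of `ℤ^I`. -/
def σ (C : CartanScheme I A) (a : A) (i : I) : (I → ℤ) ≃ₗ[ℤ] (I → ℤ) :=
  Module.reflection (C.rowForm_simpleRoot_self a i)

theorem σ_simpleRoot (C : CartanScheme I A) (a : A) (i j : I) :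
    C.σ a i (simpleRoot j) = simpleRoot j - C.cartan a i j • simpleRoot i := by
  rw [σ, Module.reflection_apply, rowForm_simpleRoot]

/-- `C.IsMorphism a b f` says that `(b, f, a)` is a morphism from `a` to `b` in the Weyl groupoid
of `C`: it is a composition of maps `σ_i^c`, each of which is a morphism from `c` to `ρ_i(c)`. -/
inductive IsMorphism (C : CartanScheme I A) : A → A → ((I → ℤ) ≃ₗ[ℤ] (I → ℤ)) → Prop
  | id (a : A) : IsMorphism C a a (LinearEquiv.refl ℤ (I → ℤ))
  | comp {a b : A} {f : (I → ℤ) ≃ₗ[ℤ] (I → ℤ)} (i : I) (hf : IsMorphism C a b f) :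
      IsMorphism C a (C.ρ i b) (f.trans (C.σ b i))

/-- The set `Hom(a, b)` of the Weyl groupoid. -/
def weylHom (C : CartanScheme I A) (a b : A) : Set ((I → ℤ) ≃ₗ[ℤ] (I → ℤ)) :=
  {f | C.IsMorphism a b f}

/-- A Cartan scheme is connected if its Weyl groupoid is connected. -/
def IsConnected (C : CartanScheme I A) : Prop :=
  ∀ a b, (C.weylHom a b).Nonempty

/-- The object change diagram, a labelled undirected graph with vertex set `A`, possibly with
multiple edges: for every `i` and every `a` with `ρ_i(a) ≠ a` there is exactly one edge with
label `i` between `a` and `ρ_i(a)`, namely `(i, {a, ρ_i(a)})`. -/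
def objectChangeDiagram (C : CartanScheme I A) : Graph A (I × Sym2 A) where
  vertexSet := Set.univ
  IsLink e a b := a ≠ b ∧ C.ρ e.1 a = b ∧ e.2 = s(a, b)
  isLink_symm e _ := ⟨by
    rintro a b ⟨hab, h, he⟩
    exact ⟨hab.symm, by rw [← h, C.ρ_ρ], by rw [he, Sym2.eq_swap]⟩⟩
  eq_or_eq_of_isLink_of_isLink := by
    rintro e x y v w ⟨-, -, h⟩ ⟨-, -, h'⟩
    rw [h, Sym2.eq_iff] at h'
    tauto
  left_mem_of_isLink := by
    intros
    trivial

end CartanScheme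

/-- The graph (with multiple edges allowed) is a cycle: its vertices `v_0, …, v_m` and its edges
`e_0, …, e_m` can be listed without repetition so that `e_k` joins `v_k` to `v_{k+1}`, with indices
modulo `m + 1`. Two vertices joined by exactly two edges form a cycle. -/
def IsCycleDiagram {V E : Type*} (G : Graph V E) : Prop :=
  ∃ (m : ℕ) (v : Fin (m + 1) ≃ G.vertexSet) (e : Fin (m + 1) ≃ G.edgeSet),
    ∀ k, G.IsLink (e k) (v k) (v (k + 1))

/-- The graph is a chain: its vertices `v_0, …, v_m` and its edges `e_0, …, e_{m-1}` can be listed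
without repetition so that `e_k` joins `v_k` to `v_{k+1}`. A single vertex without edges is a
chain. -/
def IsChainDiagram {V E : Type*} (G : Graph V E) : Prop :=
  ∃ (m : ℕ) (v : Fin (m + 1) ≃ G.vertexSet) (e : Fin m ≃ G.edgeSet),
    ∀ k : Fin m, G.IsLink (e k) (v k.castSucc) (v k.succ)

/-- A root system of type `C`, where `C` is a Cartan scheme. -/
structure CartanScheme.RootSys {I A : Type*} [Fintype I] [DecidableEq I] [Nonempty I]
    (C : CartanScheme I A) where
  /-- The set `R^a` of roots at the object `a`. -/
  roots : A → Set (I → ℤ)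
  /-- `R^a = R^a_+ ∪ -R^a_+`, where `R^a_+` is the set of roots with nonnegative coordinates. -/
  eq_pos_union_neg : ∀ a, roots a = (roots a ∩ {x | 0 ≤ x}) ∪ -(roots a ∩ {x | 0 ≤ x})
  /-- `R^a ∩ ℤα_i = {α_i, -α_i}`. -/
  inter_line : ∀ a i, roots a ∩ {x | ∃ k : ℤ, x = k • simpleRoot i} =
    {simpleRoot i, -simpleRoot i}
  /-- `σ_i^a(R^a) = R^{ρ_i(a)}`. -/
  image_σ : ∀ a i, C.σ a i '' roots a = roots (C.ρ i a)
  /-- If `i ≠ j` and `m = |R^a ∩ (ℕ₀ α_i + ℕ₀ α_j)|` is finite, then `(ρ_i ρ_j)^m (a) = a`. -/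
  iterate_eq : ∀ a i j, i ≠ j →
    (roots a ∩ {x | ∃ k l : ℕ, x = k • simpleRoot i + l • simpleRoot j}).Finite →
    (C.ρ i ∘ C.ρ j)^[(roots a ∩
      {x | ∃ k l : ℕ, x = k • simpleRoot i + l • simpleRoot j}).ncard] a = a

namespace CartanScheme.RootSys

variable {I A : Type*} [Fintype I] [DecidableEq I] [Nonempty I] {C : CartanScheme I A}

/-- A root system is finite if every `R^a` is finite. -/
def IsFinite (R : C.RootSys) : Prop := ∀ a, (R.roots a).Finite

/-- A root system is irreducible if it is not a direct sum: `I` has no partition into non-empty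
parts `J` and `Jᶜ` such that, for every object `a`, each root at `a` lies in `ℤ^J` or in
`ℤ^{Jᶜ}`. -/
def IsIrreducible (R : C.RootSys) : Prop :=
  ¬ ∃ J : Set I, J.Nonempty ∧ Jᶜ.Nonempty ∧
    ∀ a, ∀ x ∈ R.roots a, (∀ i ∈ Jᶜ, x i = 0) ∨ (∀ i ∈ J, x i = 0)

end CartanScheme.RootSys

/-! A rank two root system can be read off a sequence of vectors `v j` in `ℤ²` whose consecutive
members are oriented bases and which makes half a turn in `N` steps: a Conway-Coxeter frieze, or
equivalently a triangulated `N`-gon. At the integer `k` take the basis `-v k`, `v (k + 1)`. The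
roots are the coordinate vectors of all `v j`, and the positive ones come from `k < j ≤ k + N`. The
recursion `v (k - 1) + v (k + 1) = c • v k` says that a simple reflection is the change to the basis
at `k - 1` or `k + 1`, with Cartan entry `-c` (`FriezeQuotient.σ_friezeRoot`). Thus `ℤ`, an infinite
chain with alternating labels, serves as a set of objects, and it may be divided by label-preserving
symmetries of the frieze (`FriezeQuotient`). As there are `N` positive roots, the last axiom asks
that the translation by `2N` become trivial.

What is left is a symmetric triangulation with a vertex in many triangles. In the `6n`-gon take the
central triangle `0, 2n, 4n`, put on each of its sides a triangle with apex halfway along the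
boundary, and cut each remaining polygon by a fan from its corner on the central triangle. Then `2n
+ 1` triangles meet at `0`. The translation by `2n` is realised on `ℤ²` by `sixthTurn`, the
reflection fixing `0` by `latticeReflection`. Dividing by the translation gives a cycle with `2n`
objects; dividing also by the reflection, which sends the object `k` to `-k - 1`, folds it to a
chain with `n` objects. -/

/-! ### Friezes as sequences of vectors in the plane -/

/-- The determinant of two vectors in `ℤ²`. -/
def wedge (x y : ℤ × ℤ) : ℤ := x.1 * y.2 - x.2 * y.1

theorem wedge_self (x : ℤ × ℤ) : wedge x x = 0 := by simp [wedge, mul_comm]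

theorem wedge_swap (x y : ℤ × ℤ) : wedge x y = -wedge y x := by simp only [wedge]; ring

theorem wedge_neg_right (x y : ℤ × ℤ) : wedge x (-y) = -wedge x y := by
  simp only [wedge, Prod.fst_neg, Prod.snd_neg]; ring

theorem wedge_neg_left (x y : ℤ × ℤ) : wedge (-x) y = -wedge x y := by
  simp only [wedge, Prod.fst_neg, Prod.snd_neg]; ring

/-- This identity is behind the positivity of friezes, their three-term recursion, and the
distinctness of roots. -/
theorem wedge_pluecker (a b c d : ℤ × ℤ) :
    wedge a c * wedge b d = wedge a b * wedge c d + wedge a d * wedge b c := by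
  simp only [wedge]; ring

/-- An antiperiodic sequence of vectors in `ℤ²` in which consecutive vectors form an oriented
basis and which performs exactly half a turn within one antiperiod. The determinants of its
members are the entries of a Conway-Coxeter frieze. -/
structure IsFrieze (v : ℤ → ℤ × ℤ) (N : ℕ) : Prop where
  three_le : 3 ≤ N
  unimodular : ∀ k, wedge (v k) (v (k + 1)) = 1
  antiperiodic : ∀ k, v (k + N) = -v k
  wedge_pos : ∀ k j : ℤ, k < j → j < k + N → 0 < wedge (v k) (v j)

/-- Positivity of a single row suffices for a frieze. -/
theorem IsFrieze.of_row {v : ℤ → ℤ × ℤ} {N : ℕ} (h3 : 3 ≤ N)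
    (h1 : ∀ k, wedge (v k) (v (k + 1)) = 1) (hN : ∀ k, v (k + N) = -v k)
    (hrow : ∀ j : ℤ, 0 < j → j < N → 0 < wedge (v 0) (v j)) : IsFrieze v N := by
  have inner : ∀ k : ℤ, 0 ≤ k → ∀ j : ℤ, k + 1 ≤ j → j < N → 0 < wedge (v k) (v j) := by
    intro k hk
    rcases hk.eq_or_lt with rfl | hk
    · intro j hj hjN
      exact hrow j (by omega) hjN
    intro j hj
    induction j, hj using Int.leInduction with
    | base => intro _; rw [h1]; exact one_pos
    | succ j hj ih =>
      intro hjN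
      have a := ih (by omega)
      have b := hrow j (by omega) (by omega)
      have c := hrow (j + 1) (by omega) hjN
      have d := hrow k hk (by omega)
      -- On the right every factor is positive, so dividing by the positive entry of row zero
      -- carries positivity from `j` to `j + 1`.
      have e := wedge_pluecker (v 0) (v k) (v j) (v (j + 1))
      rw [h1] at e
      have : 0 < wedge (v 0) (v j) * wedge (v k) (v (j + 1)) := by rw [e]; positivity
      exact pos_of_mul_pos_right this b.le
  have step : ∀ k : ℤ, 0 ≤ k → k < N → ∀ j, k < j → j < k + N → 0 < wedge (v k) (v j) := by
    intro k hk hkN j hj hjN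
    -- Beyond `N`, antiperiodicity moves `j` to `j - N < k`; its sign cancels against the swap of
    -- the two arguments.
    by_cases h : j < N
    · exact inner k hk j (by omega) h
    · have e := hN (j - N)
      rw [sub_add_cancel] at e
      rw [e, wedge_neg_right, ← wedge_swap]
      exact inner (j - N) (by omega) k (by omega) hkN
  have shift : ∀ k j, wedge (v (k + N)) (v (j + N)) = wedge (v k) (v j) := by
    intro k j
    rw [hN, hN, wedge_neg_left, wedge_neg_right, neg_neg]
  have shift' : ∀ (q : ℤ) k j, wedge (v (k + q * N)) (v (j + q * N)) = wedge (v k) (v j) := by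
    intro q k j
    induction q with
    | zero => simp
    | succ q ih => rw [← ih, ← shift (k + q * N)]; congr 2 <;> ring
    | pred q ih => rw [← ih, ← shift (k + (-q - 1) * N)]; congr 2 <;> ring
  refine ⟨h3, h1, hN, fun k j hkj hjN => ?_⟩
  have hN0 : (0 : ℤ) < N := by omega
  have e := Int.emod_add_mul_ediv k N
  have l := Int.emod_nonneg k hN0.ne'
  have u := Int.emod_lt_of_pos k hN0
  have := step (k % N) l u (j - N * (k / N)) (by omega) (by omega)
  rwa [← shift' (k / N), mul_comm, e, mul_comm, sub_add_cancel] at this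

namespace IsFrieze

variable {v : ℤ → ℤ × ℤ} {N : ℕ}

theorem wedge_add_right (h : IsFrieze v N) (k j : ℤ) :
    wedge (v k) (v (j + N)) = -wedge (v k) (v j) := by
  rw [h.antiperiodic, wedge_neg_right]

/-- The three-term recursion of a frieze. -/
theorem wedge_recursion (h : IsFrieze v N) (k : ℤ) (x : ℤ × ℤ) :
    wedge (v k) x + wedge (v (k + 2)) x = wedge (v k) (v (k + 2)) * wedge (v (k + 1)) x := by
  have a := wedge_pluecker (v k) (v (k + 1)) (v (k + 2)) x
  have b := h.unimodular (k + 1)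
  rw [add_assoc, one_add_one_eq_two] at b
  rw [h.unimodular k, b] at a
  linarith

end IsFrieze

/-! ### The integers as an infinite chain with alternating labels -/

/-- The label of the integer `k`, its residue modulo two. -/
def label (k : ℤ) : Fin 2 := if Even k then 0 else 1

theorem label_add_one_ne (k : ℤ) : label (k + 1) ≠ label k := by
  unfold label
  by_cases h : Even k <;> simp [h]

theorem label_add_two (k : ℤ) : label (k + 2) = label k := by
  simp [label]

theorem label_eq_or (k : ℤ) (i : Fin 2) : i = label k ∨ i = label (k + 1) := by
  have := label_add_one_ne k
  omega

theorem label_neg (k : ℤ) : label (-k) = label k := by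
  simp [label]

theorem label_add_two_mul (k q : ℤ) : label (k + 2 * q) = label k := by
  simp [label, Int.even_add]

theorem label_sub_one (k : ℤ) : label (k - 1) = label (k + 1) := by
  rw [← label_add_two]; congr 1; ring

theorem eq_of_label_eq {x y : Fin 2 → ℤ} (k : ℤ) (h : x (label k) = y (label k))
    (h' : x (label (k + 1)) = y (label (k + 1))) : x = y := by
  ext i
  rcases label_eq_or k i with rfl | rfl <;> assumption

/-- The neighbour of the integer `k` in direction `i`: the edge between `k - 1` and `k` carries the
label of `k`. -/
def neighbour (i : Fin 2) (k : ℤ) : ℤ := if i = label k then k - 1 else k + 1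

theorem neighbour_label (k : ℤ) : neighbour (label k) k = k - 1 := by simp [neighbour]

theorem neighbour_label_add_one (k : ℤ) : neighbour (label (k + 1)) k = k + 1 := by
  simp [neighbour, label_add_one_ne]

theorem neighbour_neighbour (i : Fin 2) (k : ℤ) : neighbour i (neighbour i k) = k := by
  rcases label_eq_or k i with rfl | rfl
  · rw [neighbour_label]
    have := neighbour_label_add_one (k - 1)
    rwa [sub_add_cancel] at this
  · rw [neighbour_label_add_one, neighbour_label, add_sub_cancel_right]

theorem neighbour_add_two_mul (i : Fin 2) (k q : ℤ) :
    neighbour i (k + 2 * q) = neighbour i k + 2 * q := by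
  simp only [neighbour, label_add_two_mul]
  split_ifs <;> ring

theorem label_reflect (k : ℤ) : label (-k - 1) = label (k + 1) := by
  rw [← label_neg]; congr 1; ring

theorem neighbour_reflect (i : Fin 2) (k : ℤ) : neighbour i (-k - 1) = -neighbour i k - 1 := by
  rcases label_eq_or k i with rfl | rfl
  · simp [neighbour, label_reflect, (label_add_one_ne k).symm]
  · simp [neighbour, label_reflect, label_add_one_ne]
    ring

/-- The composition of the two neighbour maps is a shift by two. -/
theorem iterate_neighbour_comp {i j : Fin 2} (hij : i ≠ j) (m : ℕ) (k : ℤ) :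
    ∃ ε : ℤ, (neighbour i ∘ neighbour j)^[m] k = k + 2 * m * ε := by
  rcases label_eq_or k j with rfl | rfl
  · refine ⟨-1, ?_⟩
    induction m with
    | zero => simp
    | succ m ih =>
      have : i = label (k + 1) := by have := label_eq_or k i; tauto
      rw [Function.iterate_succ_apply', ih, mul_assoc, Function.comp_apply,
        neighbour_add_two_mul, neighbour_add_two_mul, neighbour_label, this, ← label_sub_one,
        neighbour_label]
      push_cast; ring
  · refine ⟨1, ?_⟩
    induction m with
    | zero => simp
    | succ m ih =>
      have : i = label (k + 2) := by rw [label_add_two]; have := label_eq_or k i; tauto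
      have e := neighbour_label_add_one (k + 1)
      rw [add_assoc, one_add_one_eq_two] at e
      rw [Function.iterate_succ_apply', ih, mul_assoc, Function.comp_apply,
        neighbour_add_two_mul, neighbour_add_two_mul, neighbour_label_add_one, this, e]
      push_cast; ring

/-! ### Roots and Cartan matrices of a frieze -/

/-- The coordinates of the vector `v j` with respect to the basis `-v k`, `v (k + 1)`. -/
def friezeRoot (v : ℤ → ℤ × ℤ) (k j : ℤ) : Fin 2 → ℤ := fun i =>
  if i = label k then wedge (v (k + 1)) (v j) else wedge (v k) (v j)

/-- The Cartan matrix at the basis `-v k`, `v (k + 1)`. -/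
def friezeCartan (v : ℤ → ℤ × ℤ) (k : ℤ) : Matrix (Fin 2) (Fin 2) ℤ := fun i j =>
  if i = j then 2 else
    if i = label k then -wedge (v (k - 1)) (v (k + 1)) else -wedge (v k) (v (k + 2))

theorem friezeRoot_label (v : ℤ → ℤ × ℤ) (k j : ℤ) :
    friezeRoot v k j (label k) = wedge (v (k + 1)) (v j) := by simp [friezeRoot]

theorem friezeRoot_label_add_one (v : ℤ → ℤ × ℤ) (k j : ℤ) :
    friezeRoot v k j (label (k + 1)) = wedge (v k) (v j) := by
  simp [friezeRoot, label_add_one_ne]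

theorem friezeCartan_label (v : ℤ → ℤ × ℤ) (k : ℤ) :
    friezeCartan v k (label k) (label (k + 1)) = -wedge (v (k - 1)) (v (k + 1)) := by
  simp [friezeCartan, (label_add_one_ne k).symm]

theorem friezeCartan_label_add_one (v : ℤ → ℤ × ℤ) (k : ℤ) :
    friezeCartan v k (label (k + 1)) (label k) = -wedge (v k) (v (k + 2)) := by
  simp [friezeCartan, label_add_one_ne]

/-- The bases at two adjacent integers share one vector up to sign, and the row in question depends
only on the two neighbours of that vector in the sequence. -/
theorem friezeCartan_neighbour (v : ℤ → ℤ × ℤ) (k : ℤ) (i j : Fin 2) :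
    friezeCartan v k i j = friezeCartan v (neighbour i k) i j := by
  unfold friezeCartan
  by_cases hij : i = j
  · simp [hij]
  rcases label_eq_or k i with rfl | rfl
  · have h : label k ≠ label (k - 1) := by rw [label_sub_one]; exact (label_add_one_ne k).symm
    simp only [hij, h, neighbour_label, if_true, if_false]
    congr 3; ring
  · simp only [hij, label_add_one_ne, neighbour_label_add_one, if_true, if_false,
      add_sub_cancel_right]
    congr 3; ring

namespace IsFrieze

variable {v : ℤ → ℤ × ℤ} {N : ℕ}

theorem friezeCartan_neg (h : IsFrieze v N) (k : ℤ) {i j : Fin 2} (hij : i ≠ j) :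
    friezeCartan v k i j < 0 := by
  have := h.three_le
  have a := h.wedge_pos (k - 1) (k + 1) (by omega) (by omega)
  have b := h.wedge_pos k (k + 2) (by omega) (by omega)
  simp only [friezeCartan, hij, if_false]
  split_ifs <;> omega

theorem isGeneralizedCartanMatrix (h : IsFrieze v N) (k : ℤ) :
    IsGeneralizedCartanMatrix (friezeCartan v k) where
  diag i := by simp [friezeCartan]
  nonpos i j hij := (h.friezeCartan_neg k hij).le
  zero_symm i j hij := by
    by_cases e : i = j
    · simp [friezeCartan, e] at hij
    · exact absurd hij (h.friezeCartan_neg k e).ne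

theorem isIndecomposable (h : IsFrieze v N) (k : ℤ) :
    IsIndecomposableCartanMatrix (friezeCartan v k) := by
  rintro ⟨J, ⟨i, hi⟩, ⟨j, hj⟩, H⟩
  have hij : i ≠ j := by rintro rfl; exact hj hi
  exact (h.friezeCartan_neg k hij).ne (H i hi j hj).1

theorem friezeRoot_add (h : IsFrieze v N) (k j : ℤ) :
    friezeRoot v k (j + N) = -friezeRoot v k j := by
  ext i
  simp only [friezeRoot, h.wedge_add_right, Pi.neg_apply]
  split_ifs <;> rfl

theorem neg_mem_range (h : IsFrieze v N) (k : ℤ) {x : Fin 2 → ℤ}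
    (hx : x ∈ Set.range (friezeRoot v k)) : -x ∈ Set.range (friezeRoot v k) := by
  obtain ⟨j, rfl⟩ := hx
  exact ⟨j + N, h.friezeRoot_add k j⟩

/-- Every index is congruent modulo `N` to one in the half-open interval after `k`. -/
theorem exists_friezeRoot_eq (h : IsFrieze v N) (k j : ℤ) : ∃ l, k < l ∧ l ≤ k + N ∧
    (friezeRoot v k j = friezeRoot v k l ∨ friezeRoot v k j = -friezeRoot v k l) := by
  have per : ∀ (q j : ℤ), friezeRoot v k (j + q * N) = friezeRoot v k j ∨
      friezeRoot v k (j + q * N) = -friezeRoot v k j := by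
    intro q j
    induction q with
    | zero => simp
    | succ q ih =>
      have e : j + ((q : ℤ) + 1) * N = j + q * N + N := by ring
      rw [e, h.friezeRoot_add]
      rcases ih with ih | ih <;> simp [ih]
    | pred q ih =>
      have e : j + (-(q : ℤ)) * N = j + (-q - 1) * N + N := by ring
      rw [e, h.friezeRoot_add, neg_eq_iff_eq_neg, neg_inj] at ih
      exact ih.symm
  have hN : (0 : ℤ) < N := by have := h.three_le; omega
  have e := Int.emod_add_mul_ediv (j - k - 1) N
  have l := Int.emod_nonneg (j - k - 1) hN.ne'
  have u := Int.emod_lt_of_pos (j - k - 1) hN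
  refine ⟨k + 1 + (j - k - 1) % N, by omega, by omega, ?_⟩
  have := per ((j - k - 1) / N) (k + 1 + (j - k - 1) % N)
  rwa [show k + 1 + (j - k - 1) % N + (j - k - 1) / N * N = j by linarith] at this

theorem friezeRoot_nonneg (h : IsFrieze v N) {k j : ℤ} (hk : k < j) (hj : j ≤ k + N) :
    0 ≤ friezeRoot v k j := by
  intro i
  rcases label_eq_or k i with rfl | rfl
  · rw [friezeRoot_label]
    rcases (show k + 1 ≤ j by omega).eq_or_lt with e | e
    · rw [e, wedge_self]; rfl
    · exact (h.wedge_pos _ _ e (by omega)).le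
  · rw [friezeRoot_label_add_one]
    rcases hj.eq_or_lt with e | e
    · rw [e, h.wedge_add_right, wedge_self]; rfl
    · exact (h.wedge_pos _ _ hk e).le

/-- Equal coordinates force `wedge (v a) (v b) = 0` by the Plücker relation, against positivity for
`a < b < a + N`. -/
theorem friezeRoot_injOn (h : IsFrieze v N) (k : ℤ) :
    Set.InjOn (friezeRoot v k) (Set.Ioc k (k + N)) := by
  have key : ∀ a b, a ∈ Set.Ioc k (k + N) → b ∈ Set.Ioc k (k + N) →
      friezeRoot v k a = friezeRoot v k b → ¬ a < b := by
    intro a b ha hb e hab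
    have e1 := congrFun e (label k)
    have e2 := congrFun e (label (k + 1))
    rw [friezeRoot_label, friezeRoot_label] at e1
    rw [friezeRoot_label_add_one, friezeRoot_label_add_one] at e2
    have p := h.wedge_pos a b hab (by have := ha.1; have := hb.2; omega)
    have q := wedge_pluecker (v k) (v (k + 1)) (v a) (v b)
    rw [e1, e2, h.unimodular] at q
    linarith
  intro a ha b hb e
  exact le_antisymm (not_lt.1 (key b a hb ha e.symm)) (not_lt.1 (key a b ha hb e))

theorem friezeRoot_add_one (h : IsFrieze v N) (k : ℤ) :
    friezeRoot v k (k + 1) = Pi.single (label (k + 1)) 1 := by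
  apply eq_of_label_eq k
  · simp [friezeRoot_label, wedge_self, (label_add_one_ne k).symm]
  · simp [friezeRoot_label_add_one, h.unimodular]

theorem friezeRoot_top (h : IsFrieze v N) (k : ℤ) :
    friezeRoot v k (k + N) = Pi.single (label k) 1 := by
  apply eq_of_label_eq k
  · rw [friezeRoot_label, h.wedge_add_right, ← wedge_swap]; simp [h.unimodular]
  · rw [friezeRoot_label_add_one, h.wedge_add_right]
    simp [wedge_self, label_add_one_ne]

theorem friezeRoot_pos (h : IsFrieze v N) {k j : ℤ} (hk : k + 1 < j) (hj : j < k + N)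
    (i : Fin 2) : 0 < friezeRoot v k j i := by
  rcases label_eq_or k i with rfl | rfl
  · rw [friezeRoot_label]
    exact h.wedge_pos _ _ hk (by omega)
  · rw [friezeRoot_label_add_one]
    exact h.wedge_pos _ _ (by omega) hj

/-- The positive vectors among the roots are those in one antiperiod. -/
theorem range_inter_nonneg (h : IsFrieze v N) (k : ℤ) :
    Set.range (friezeRoot v k) ∩ {x | 0 ≤ x} = friezeRoot v k '' Set.Ioc k (k + N) := by
  ext x
  constructor
  · rintro ⟨⟨j, rfl⟩, hx⟩
    obtain ⟨l, h1, h2, e | e⟩ := h.exists_friezeRoot_eq k j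
    · exact ⟨l, ⟨h1, h2⟩, e.symm⟩
    · have a := h.friezeRoot_nonneg h1 h2
      rw [Set.mem_ofPred_eq, e] at hx
      -- No root is zero, but this need not be known here: a zero vector is its own negative and so
      -- lies in the image anyway.
      have z : friezeRoot v k l = 0 := le_antisymm (neg_nonneg.1 hx) a
      exact ⟨l, ⟨h1, h2⟩, by rw [e, z, neg_zero]⟩
  · rintro ⟨j, ⟨h1, h2⟩, rfl⟩
    exact ⟨⟨j, rfl⟩, h.friezeRoot_nonneg h1 h2⟩

theorem range_eq_union (h : IsFrieze v N) (k : ℤ) :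
    Set.range (friezeRoot v k) = (Set.range (friezeRoot v k) ∩ {x | 0 ≤ x}) ∪
      -(Set.range (friezeRoot v k) ∩ {x | 0 ≤ x}) := by
  ext x
  constructor
  · rintro ⟨j, rfl⟩
    obtain ⟨l, h1, h2, e | e⟩ := h.exists_friezeRoot_eq k j
    · left
      rw [e]
      exact ⟨⟨l, rfl⟩, h.friezeRoot_nonneg h1 h2⟩
    · right
      rw [e, Set.mem_neg, neg_neg]
      exact ⟨⟨l, rfl⟩, h.friezeRoot_nonneg h1 h2⟩
  · rintro (hx | hx)
    · exact hx.1
    · simpa using h.neg_mem_range k hx.1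

theorem range_finite (h : IsFrieze v N) (k : ℤ) : (Set.range (friezeRoot v k)).Finite := by
  have : (Set.range (friezeRoot v k) ∩ {x | 0 ≤ x}).Finite := by
    rw [h.range_inter_nonneg]
    exact (Set.finite_Ioc _ _).image _
  rw [h.range_eq_union]
  exact this.union this.neg

theorem ncard_range_inter_nonneg (h : IsFrieze v N) (k : ℤ) :
    (Set.range (friezeRoot v k) ∩ {x | 0 ≤ x}).ncard = N := by
  rw [h.range_inter_nonneg, (h.friezeRoot_injOn k).ncard_image,
    ← Finset.coe_Ioc, Set.ncard_coe_finset]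
  simp

/-- Within one antiperiod the two end indices `k + 1` and `k + N` give the simple roots, and every
index strictly between gives two positive coordinates. -/
theorem range_inter_line (h : IsFrieze v N) (k : ℤ) (i : Fin 2) :
    Set.range (friezeRoot v k) ∩ {x | ∃ m : ℤ, x = m • CartanScheme.simpleRoot i} =
      {CartanScheme.simpleRoot i, -CartanScheme.simpleRoot i} := by
  have hs : CartanScheme.simpleRoot i ∈ Set.range (friezeRoot v k) := by
    rcases label_eq_or k i with rfl | rfl
    · exact ⟨_, h.friezeRoot_top k⟩
    · exact ⟨_, h.friezeRoot_add_one k⟩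
  have line : ∀ l, k < l → l ≤ k + N → ∀ m : ℤ,
      friezeRoot v k l = m • CartanScheme.simpleRoot i →
        friezeRoot v k l = CartanScheme.simpleRoot i := by
    intro l h1 h2 m hm
    have z : ∀ i', i' ≠ i → friezeRoot v k l i' = 0 := by
      intro i' hi'
      rw [hm]; simp [CartanScheme.simpleRoot, hi']
    rcases (show k + 1 ≤ l by omega).eq_or_lt with rfl | e1
    · rw [h.friezeRoot_add_one] at z ⊢
      by_cases hi : label (k + 1) = i
      · rw [hi]; rfl
      · simpa using z _ hi
    rcases h2.eq_or_lt with rfl | e2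
    · rw [h.friezeRoot_top] at z ⊢
      by_cases hi : label k = i
      · rw [hi]; rfl
      · simpa using z _ hi
    · obtain ⟨i', hi'⟩ := exists_ne i
      exact absurd (z i' hi') (h.friezeRoot_pos e1 e2 i').ne'
  ext x
  constructor
  · rintro ⟨⟨j, rfl⟩, m, hm⟩
    obtain ⟨l, h1, h2, e | e⟩ := h.exists_friezeRoot_eq k j
    · left
      rw [e] at hm ⊢
      exact line l h1 h2 m hm
    · right
      rw [e] at hm ⊢
      rw [line l h1 h2 (-m) (by rw [neg_smul, ← hm, neg_neg])]
      rfl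
  · rintro (rfl | rfl)
    · exact ⟨hs, 1, by simp⟩
    · exact ⟨h.neg_mem_range k hs, -1, by simp⟩

theorem not_decomposable (h : IsFrieze v N) (k : ℤ) {J : Set (Fin 2)} (hJ : J.Nonempty)
    (hJ' : Jᶜ.Nonempty) : ¬ ∀ x ∈ Set.range (friezeRoot v k),
      (∀ i ∈ Jᶜ, x i = 0) ∨ (∀ i ∈ J, x i = 0) := by
  intro H
  have := h.three_le
  -- Since `N ≥ 3`, the index `k + 2` is interior and its root has full support.
  have p := h.friezeRoot_pos (k := k) (j := k + 2) (by omega) (by omega)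
  obtain ⟨i, hi⟩ := hJ
  obtain ⟨j, hj⟩ := hJ'
  rcases H _ ⟨k + 2, rfl⟩ with H | H
  · exact (p j).ne' (H j hj)
  · exact (p i).ne' (H i hi)

end IsFrieze

/-! ### Root systems from quotients of the infinite chain -/

theorem CartanScheme.σ_apply_fin_two {A : Type*} (C : CartanScheme (Fin 2) A) (a : A) {i j : Fin 2}
    (hij : j ≠ i) (x : Fin 2 → ℤ) :
    C.σ a i x i = -x i - C.cartan a i j * x j ∧ C.σ a i x j = x j := by
  have hd := (C.isGCM a).diag i
  have hs : C.rowForm a i x = C.cartan a i i * x i + C.cartan a i j * x j := by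
    have : (Finset.univ : Finset (Fin 2)) = {i, j} := by ext l; simp; omega
    change ∑ l, C.cartan a i l * x l = _
    rw [this, Finset.sum_pair hij.symm]
  rw [CartanScheme.σ, Module.reflection_apply, hs, hd]
  constructor
  · simp only [CartanScheme.simpleRoot, Pi.sub_apply, Pi.smul_apply, Pi.single_eq_same, smul_eq_mul]
    ring
  · simp [CartanScheme.simpleRoot, hij]

/-- A set `A` of representatives of the integers, with respect to identifications that are
compatible with the frieze `v`. -/
structure FriezeQuotient (v : ℤ → ℤ × ℤ) (N : ℕ) (A : Type*) where
  isFrieze : IsFrieze v N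
  proj : ℤ → A
  lift : A → ℤ
  proj_lift : ∀ a, proj (lift a) = a
  proj_neighbour : ∀ i k, proj (neighbour i (lift (proj k))) = proj (neighbour i k)
  cartan_lift : ∀ k, friezeCartan v (lift (proj k)) = friezeCartan v k
  range_lift : ∀ k, Set.range (friezeRoot v (lift (proj k))) = Set.range (friezeRoot v k)
  proj_add : ∀ k ε : ℤ, proj (k + 2 * N * ε) = proj k

namespace FriezeQuotient

variable {v : ℤ → ℤ × ℤ} {N : ℕ} {A : Type*} (Q : FriezeQuotient v N A)

/-- The Cartan scheme of rank two attached to a quotient of a frieze. -/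
def scheme : CartanScheme (Fin 2) A where
  nonempty_objects := ⟨Q.proj 0⟩
  ρ i a := Q.proj (neighbour i (Q.lift a))
  cartan a := friezeCartan v (Q.lift a)
  isGCM a := Q.isFrieze.isGeneralizedCartanMatrix _
  ρ_ρ i a := by rw [Q.proj_neighbour, neighbour_neighbour, Q.proj_lift]
  row_eq a i j := by rw [Q.cartan_lift, ← friezeCartan_neighbour]

theorem scheme_ρ_proj (i : Fin 2) (k : ℤ) :
    Q.scheme.ρ i (Q.proj k) = Q.proj (neighbour i k) := Q.proj_neighbour i k

/-- The reflection is a change of basis: the vector `v j` stays fixed, and the three-term recursion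
supplies its one new coordinate. -/
theorem σ_friezeRoot (a : A) (i : Fin 2) (j : ℤ) :
    Q.scheme.σ a i (friezeRoot v (Q.lift a) j) = friezeRoot v (neighbour i (Q.lift a)) j := by
  have hc : Q.scheme.cartan a = friezeCartan v (Q.lift a) := rfl
  generalize Q.lift a = k at hc
  rcases label_eq_or k i with rfl | rfl
  · obtain ⟨h1, h2⟩ := Q.scheme.σ_apply_fin_two a (label_add_one_ne k) (friezeRoot v k j)
    have e := friezeRoot_label_add_one v (k - 1) j
    have e' := friezeRoot_label v (k - 1) j
    rw [sub_add_cancel] at e e'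
    rw [label_sub_one] at e'
    have r := Q.isFrieze.wedge_recursion (k - 1) (v j)
    rw [sub_add_cancel, show k - 1 + 2 = k + 1 by ring] at r
    apply eq_of_label_eq k
    · rw [h1, hc, neighbour_label, friezeCartan_label, friezeRoot_label, friezeRoot_label_add_one,
        e]
      linarith
    · rw [h2, neighbour_label, friezeRoot_label_add_one, e']
  · obtain ⟨h1, h2⟩ := Q.scheme.σ_apply_fin_two a (label_add_one_ne k).symm (friezeRoot v k j)
    have e := friezeRoot_label_add_one v (k + 1) j
    have e' := friezeRoot_label v (k + 1) j
    rw [add_assoc, one_add_one_eq_two] at e e'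
    rw [label_add_two] at e
    have r := Q.isFrieze.wedge_recursion k (v j)
    apply eq_of_label_eq k
    · rw [h2, neighbour_label_add_one, friezeRoot_label, e]
    · rw [h1, hc, neighbour_label_add_one, friezeCartan_label_add_one, friezeRoot_label,
        friezeRoot_label_add_one, e']
      linarith

/-- In rank two the cone in the last axiom is the whole quadrant, so the number `m` there counts all
positive roots and equals `N`. -/
theorem simpleRoot_combinations {i j : Fin 2} (hij : i ≠ j) :
    {x : Fin 2 → ℤ | ∃ k l : ℕ, x = k • CartanScheme.simpleRoot i + l • CartanScheme.simpleRoot j} =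
      {x | 0 ≤ x} := by
  ext x
  constructor
  · rintro ⟨k, l, rfl⟩ m
    simp only [CartanScheme.simpleRoot, Pi.zero_apply, Pi.add_apply, Pi.smul_apply,
      Pi.single_apply]
    split_ifs <;> positivity
  · intro hx
    refine ⟨(x i).toNat, (x j).toNat, ?_⟩
    ext m
    have hm : m = i ∨ m = j := by omega
    rcases hm with rfl | rfl
    · simp [CartanScheme.simpleRoot, hij, Int.toNat_of_nonneg (hx m)]
    · simp [CartanScheme.simpleRoot, hij.symm, Int.toNat_of_nonneg (hx m)]

theorem iterate_ρ (i j : Fin 2) (m : ℕ) (k : ℤ) :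
    (Q.scheme.ρ i ∘ Q.scheme.ρ j)^[m] (Q.proj k) = Q.proj ((neighbour i ∘ neighbour j)^[m] k) := by
  induction m with
  | zero => rfl
  | succ m ih =>
    rw [Function.iterate_succ_apply', Function.iterate_succ_apply', ih, Function.comp_apply,
      scheme_ρ_proj, scheme_ρ_proj, Function.comp_apply]

/-- The root system of rank two attached to a quotient of a frieze. -/
def rootSys : Q.scheme.RootSys where
  roots a := Set.range (friezeRoot v (Q.lift a))
  eq_pos_union_neg a := Q.isFrieze.range_eq_union _
  inter_line a i := Q.isFrieze.range_inter_line _ i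
  image_σ a i := by
    rw [← Set.range_comp]
    change _ = Set.range (friezeRoot v (Q.lift (Q.proj (neighbour i (Q.lift a)))))
    rw [Q.range_lift]
    congr 1
    ext1 j
    exact Q.σ_friezeRoot a i j
  iterate_eq a i j hij _ := by
    rw [simpleRoot_combinations hij, Q.isFrieze.ncard_range_inter_nonneg]
    obtain ⟨ε, h⟩ := iterate_neighbour_comp hij N (Q.lift a)
    have := Q.iterate_ρ i j N (Q.lift a)
    rwa [h, Q.proj_add, Q.proj_lift] at this

theorem isConnected : Q.scheme.IsConnected := by
  intro a b
  have key : ∀ m : ℤ, (Q.scheme.weylHom a (Q.proj (Q.lift a + m))).Nonempty := by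
    intro m
    have step : ∀ (k : ℤ) (i : Fin 2), (Q.scheme.weylHom a (Q.proj k)).Nonempty →
        (Q.scheme.weylHom a (Q.proj (neighbour i k))).Nonempty := by
      rintro k i ⟨f, hf⟩
      rw [← scheme_ρ_proj]
      exact ⟨_, .comp i hf⟩
    induction m with
    | zero => rw [add_zero, Q.proj_lift]; exact ⟨_, .id a⟩
    | succ m ih =>
      have := step _ (label (Q.lift a + m + 1)) ih
      rwa [neighbour_label_add_one, add_assoc] at this
    | pred m ih =>
      have := step _ (label (Q.lift a + -m)) ih
      rwa [neighbour_label, add_sub_assoc] at this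
  have := key (Q.lift b - Q.lift a)
  rwa [add_sub_cancel, Q.proj_lift] at this

theorem isFinite : Q.rootSys.IsFinite := fun _ => Q.isFrieze.range_finite _

theorem isIrreducible : Q.rootSys.IsIrreducible := by
  rintro ⟨J, hJ, hJ', H⟩
  exact Q.isFrieze.not_decomposable _ hJ hJ' (H (Q.proj 0))

theorem isIndecomposable (a : A) : IsIndecomposableCartanMatrix (Q.scheme.cartan a) :=
  Q.isFrieze.isIndecomposable _

theorem exists_cartan_eq (k : ℤ) :
    ∃ a i j, Q.scheme.cartan a i j = -wedge (v (k - 1)) (v (k + 1)) :=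
  ⟨Q.proj k, label k, label (k + 1), by
    rw [← friezeCartan_label]; exact congrFun (congrFun (Q.cartan_lift k) _) _⟩

end FriezeQuotient

/-! ### Symmetries of a frieze acting on objects -/

section Invariance

variable {v : ℤ → ℤ × ℤ}

/-- The shift must be even so that the two coordinates keep their labels. -/
theorem range_friezeRoot_add_two_mul {q : ℤ}
    (h : ∀ k j, wedge (v (k + 2 * q)) (v (j + 2 * q)) = wedge (v k) (v j)) (k : ℤ) :
    Set.range (friezeRoot v (k + 2 * q)) = Set.range (friezeRoot v k) := by
  rw [← (Equiv.addRight (2 * q)).surjective.range_comp (friezeRoot v (k + 2 * q))]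
  congr 1
  ext j i
  simp only [Function.comp_apply, Equiv.coe_addRight, friezeRoot, label_add_two_mul, h]
  rw [add_right_comm, h]

theorem friezeCartan_add_two_mul {q : ℤ}
    (h : ∀ k j, wedge (v (k + 2 * q)) (v (j + 2 * q)) = wedge (v k) (v j)) (k : ℤ) :
    friezeCartan v (k + 2 * q) = friezeCartan v k := by
  ext i j
  simp only [friezeCartan, label_add_two_mul]
  rw [add_sub_right_comm, add_right_comm k _ 1, add_right_comm k _ 2, h, h]

/-- The reflection `j ↦ -j` takes the pair `k, k + 1` to `-k, -k - 1`, hence the object `k` to `-k -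
1`. Being orientation-reversing, it negates each root, which the symmetry of the root set under
negation absorbs. -/
theorem range_friezeRoot_reflect {N : ℕ} (hv : IsFrieze v N)
    (h : ∀ k j, wedge (v (-k)) (v (-j)) = -wedge (v k) (v j)) (k : ℤ) :
    Set.range (friezeRoot v (-k - 1)) = Set.range (friezeRoot v k) := by
  have key : ∀ j, friezeRoot v (-k - 1) (-j) = -friezeRoot v k j := by
    intro j
    have e := friezeRoot_label v (-k - 1) (-j)
    have e' := friezeRoot_label_add_one v (-k - 1) (-j)
    rw [sub_add_cancel, h] at e
    have e'' : wedge (v (-k - 1)) (v (-j)) = -wedge (v (k + 1)) (v j) := by rw [← neg_add', h]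
    rw [sub_add_cancel, label_neg, e''] at e'
    rw [label_reflect] at e
    apply eq_of_label_eq k
    · rw [e', Pi.neg_apply, friezeRoot_label]
    · rw [e, Pi.neg_apply, friezeRoot_label_add_one]
  ext x
  constructor
  · rintro ⟨j, rfl⟩
    rw [← neg_neg j, key]
    exact hv.neg_mem_range k ⟨_, rfl⟩
  · rintro ⟨j, rfl⟩
    rw [← neg_neg (friezeRoot v k j), ← key]
    exact hv.neg_mem_range _ ⟨_, rfl⟩

theorem friezeCartan_reflect (h : ∀ k j, wedge (v (-k)) (v (-j)) = -wedge (v k) (v j)) (k : ℤ) :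
    friezeCartan v (-k - 1) = friezeCartan v k := by
  ext i j
  simp only [friezeCartan]
  by_cases hij : i = j
  · simp [hij]
  have e1 : wedge (v (-k - 1 - 1)) (v (-k - 1 + 1)) = wedge (v k) (v (k + 2)) := by
    rw [show -k - 1 - 1 = -(k + 2) by ring, sub_add_cancel, h, ← wedge_swap]
  have e2 : wedge (v (-k - 1)) (v (-k - 1 + 2)) = wedge (v (k - 1)) (v (k + 1)) := by
    rw [show -k - 1 + 2 = -(k - 1) by ring, ← neg_add', h, ← wedge_swap]
  rw [e1, e2, label_reflect]
  rcases label_eq_or k i with rfl | rfl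
  · simp [hij, (label_add_one_ne k).symm]
  · simp [hij, label_add_one_ne]

end Invariance

/-! ### The star frieze in the hexagonal lattice -/

/-- The automorphism of order six of the hexagonal lattice: a turn by a sixth. -/
def sixthTurn : (ℤ × ℤ) ≃ₗ[ℤ] (ℤ × ℤ) where
  toFun x := (-x.2, x.1 + x.2)
  invFun x := (x.1 + x.2, -x.1)
  map_add' x y := by ext <;> simp <;> ring
  map_smul' r x := by ext <;> simp; ring
  left_inv x := by ext <;> simp
  right_inv x := by ext <;> simp

theorem sixthTurn_apply (x : ℤ × ℤ) : sixthTurn x = (-x.2, x.1 + x.2) := rfl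

theorem sixthTurn_inv_apply (x : ℤ × ℤ) : sixthTurn⁻¹ x = (x.1 + x.2, -x.1) := rfl

/-- A reflection of the hexagonal lattice. -/
def latticeReflection : (ℤ × ℤ) ≃ₗ[ℤ] (ℤ × ℤ) where
  toFun x := (x.1 + x.2, -x.2)
  invFun x := (x.1 + x.2, -x.2)
  map_add' x y := by ext <;> simp <;> ring
  map_smul' r x := by ext <;> simp; ring
  left_inv x := by ext <;> simp
  right_inv x := by ext <;> simp

theorem latticeReflection_apply (x : ℤ × ℤ) : latticeReflection x = (x.1 + x.2, -x.2) := rfl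

theorem wedge_sixthTurn_zpow (q : ℤ) (x y : ℤ × ℤ) :
    wedge ((sixthTurn ^ q) x) ((sixthTurn ^ q) y) = wedge x y := by
  have step : ∀ x y, wedge (sixthTurn x) (sixthTurn y) = wedge x y := by
    intro x y; simp only [wedge, sixthTurn_apply]; ring
  induction q with
  | zero => rfl
  | succ q ih => rw [add_comm, zpow_one_add, LinearEquiv.mul_apply, LinearEquiv.mul_apply, step, ih]
  | pred q ih =>
    rw [← ih, ← step, ← LinearEquiv.mul_apply, ← LinearEquiv.mul_apply, ← zpow_one_add,
      add_sub_cancel]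

theorem wedge_latticeReflection (x y : ℤ × ℤ) :
    wedge (latticeReflection x) (latticeReflection y) = -wedge x y := by
  simp only [wedge, latticeReflection_apply]; ring

theorem latticeReflection_sixthTurn_zpow (q : ℤ) (x : ℤ × ℤ) :
    latticeReflection ((sixthTurn ^ (-q)) x) = (sixthTurn ^ q) (latticeReflection x) := by
  have : SemiconjBy latticeReflection sixthTurn⁻¹ sixthTurn := by
    refine LinearEquiv.ext fun x => ?_
    simp only [LinearEquiv.mul_apply, sixthTurn_apply, sixthTurn_inv_apply, latticeReflection_apply]
    ext <;> simp
  have h := this.zpow_right q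
  rw [inv_zpow'] at h
  exact LinearEquiv.congr_fun h x

/-- The vectors in a sixth of the full turn. -/
def sectorVector (n r : ℤ) : ℤ × ℤ :=
  if r = 0 then (1, 0) else if r ≤ n then (n - r + 1, 1) else (1, r - n + 1)

/-- The frieze of the triangulation of the `6n`-gon that is invariant under rotations of order
three and reflections. -/
def starVector (n j : ℤ) : ℤ × ℤ := (sixthTurn ^ (j / (2 * n))) (sectorVector n (j % (2 * n)))

section Star

variable {n : ℤ}

theorem starVector_of_lt {r : ℤ} (h0 : 0 ≤ r) (h : r < 2 * n) :
    starVector n r = sectorVector n r := by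
  rw [starVector, Int.ediv_eq_zero_of_lt h0 h, Int.emod_eq_of_lt h0 h]; rfl

theorem starVector_add_mul (hn : 0 < n) (j q : ℤ) :
    starVector n (j + 2 * n * q) = (sixthTurn ^ q) (starVector n j) := by
  rw [starVector, starVector, Int.add_mul_ediv_left _ _ (by omega), Int.add_mul_emod_self_left,
    add_comm, zpow_add, LinearEquiv.mul_apply]

theorem wedge_starVector_add_mul (hn : 0 < n) (q k j : ℤ) :
    wedge (starVector n (k + 2 * (n * q))) (starVector n (j + 2 * (n * q))) =
      wedge (starVector n k) (starVector n j) := by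
  rw [← mul_assoc, starVector_add_mul hn, starVector_add_mul hn, wedge_sixthTurn_zpow]

theorem exists_eq_add_mul (hn : 0 < n) (k : ℤ) :
    ∃ r q : ℤ, 0 ≤ r ∧ r < 2 * n ∧ k = r + 2 * n * q :=
  ⟨k % (2 * n), k / (2 * n), Int.emod_nonneg _ (by omega), Int.emod_lt_of_pos _ (by omega),
    (Int.emod_add_mul_ediv _ _).symm⟩

theorem starVector_two_mul (hn : 0 < n) : starVector n (2 * n) = (0, 1) := by
  have := starVector_add_mul hn 0 1
  rw [zero_add, mul_one, starVector_of_lt le_rfl (by omega)] at this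
  rw [this]
  rfl

theorem wedge_starVector_succ (hn : 0 < n) (k : ℤ) :
    wedge (starVector n k) (starVector n (k + 1)) = 1 := by
  obtain ⟨r, q, h0, h1, rfl⟩ := exists_eq_add_mul hn k
  rw [add_right_comm, mul_assoc, wedge_starVector_add_mul hn, starVector_of_lt h0 h1]
  -- For the last index of a sector, the successor is the first vector `(0, 1)` of the next one.
  rcases (show r + 1 ≤ 2 * n by omega).eq_or_lt with e | e
  · rw [e, starVector_two_mul hn]
    unfold sectorVector wedge
    split_ifs <;> (simp; try omega)
  · rw [starVector_of_lt (by omega) e]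
    unfold sectorVector wedge
    split_ifs <;> first
      | omega
      | (simp; done)
      | (simp; omega)
      | (ring; done)
      | (obtain rfl : r = n := by omega
         ring)

theorem starVector_antiperiodic (hn : 0 < n) (k : ℤ) :
    starVector n (k + 6 * n) = -starVector n k := by
  rw [show 6 * n = 2 * n * 3 by ring, starVector_add_mul hn]
  generalize starVector n k = x
  change sixthTurn (sixthTurn (sixthTurn x)) = -x
  simp only [sixthTurn_apply]
  ext <;> simp

theorem starVector_row (hn : 0 < n) {j : ℤ} (h0 : 0 < j) (h1 : j < 6 * n) :
    0 < wedge (starVector n 0) (starVector n j) := by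
  rw [starVector_of_lt le_rfl (by omega)]
  have e : ∀ x, wedge (sectorVector n 0) x = x.2 := by simp [wedge, sectorVector]
  rw [e]
  obtain ⟨r, q, hr0, hr1, rfl⟩ := exists_eq_add_mul hn j
  rw [starVector_add_mul hn, starVector_of_lt hr0 hr1]
  -- Half a turn consists of three sectors. On them the second coordinate of the turned vector `x`
  -- is `x.2`, `x.1 + x.2` and `x.1` respectively; only the first can vanish, at `j = 0`.
  have hq : q = 0 ∨ q = 1 ∨ q = 2 := by
    have : -1 < q := by by_contra h; nlinarith
    have : q < 3 := by by_contra h; nlinarith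
    omega
  rcases hq with rfl | rfl | rfl
  · change 0 < (sectorVector n r).2
    unfold sectorVector
    split_ifs <;> simp <;> omega
  · change 0 < (sectorVector n r).1 + (sectorVector n r).2
    unfold sectorVector
    split_ifs <;> simp <;> omega
  · change 0 < -(sectorVector n r).2 + ((sectorVector n r).1 + (sectorVector n r).2)
    unfold sectorVector
    split_ifs <;> simp <;> omega

theorem latticeReflection_starVector (hn : 0 < n) (k : ℤ) :
    latticeReflection (starVector n (-k)) = starVector n k := by
  obtain ⟨r, q, h0, h1, rfl⟩ := exists_eq_add_mul hn k
  rw [show -(r + 2 * n * q) = -r + 2 * n * -q by ring, starVector_add_mul hn,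
    starVector_add_mul hn, latticeReflection_sixthTurn_zpow]
  congr 1
  rcases h0.eq_or_lt with rfl | h0
  · rw [neg_zero, starVector_of_lt le_rfl h1]; simp [sectorVector, latticeReflection_apply]
  -- The index `-r` lies in the preceding sector, at position `2n - r`.
  · rw [show -r = 2 * n - r + 2 * n * -1 by ring, starVector_add_mul hn,
      latticeReflection_sixthTurn_zpow, zpow_one, starVector_of_lt (by omega) (by omega),
      starVector_of_lt h0.le h1, latticeReflection_apply, sixthTurn_apply]
    unfold sectorVector
    split_ifs <;> ext <;> simp <;> omega

theorem wedge_starVector_neg (hn : 0 < n) (k j : ℤ) :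
    wedge (starVector n (-k)) (starVector n (-j)) = -wedge (starVector n k) (starVector n j) := by
  rw [← latticeReflection_starVector hn k, ← latticeReflection_starVector hn j,
    wedge_latticeReflection, neg_neg]

/-- The neighbours of `v 0` are `v 1 = (n, 1)` and its mirror image `v (-1) = (n + 1, -1)`. -/
theorem wedge_starVector_neg_one (hn : 0 < n) :
    wedge (starVector n (0 - 1)) (starVector n (0 + 1)) = 2 * n + 1 := by
  have := latticeReflection_starVector hn (0 - 1)
  rw [neg_sub, sub_zero] at this
  rw [← this, zero_add, starVector_of_lt (by omega) (by omega), latticeReflection_apply]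
  have e : sectorVector n 1 = (n, 1) := by
    unfold sectorVector
    split_ifs <;> simp <;> omega
  rw [e]
  simp only [wedge]
  ring

end Star

theorem isFrieze_starVector {n : ℕ} (hn : 1 ≤ n) : IsFrieze (starVector n) (6 * n) := by
  have h : (0 : ℤ) < n := by omega
  refine .of_row (by omega) (wedge_starVector_succ h) (fun k => ?_) fun j h0 h1 => ?_
  · exact_mod_cast starVector_antiperiodic h k
  · exact starVector_row h h0 (by exact_mod_cast h1)

/-! ### Dividing by translations: the cycle -/

section Cyclic

/-- The projection of the integers to the residues modulo `m + 1`. -/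
def cyclicProj (m : ℕ) (k : ℤ) : Fin (m + 1) :=
  ⟨(k % (m + 1 : ℤ)).toNat, by
    have := Int.emod_nonneg k (show (m + 1 : ℤ) ≠ 0 by omega)
    have := Int.emod_lt_of_pos k (show (0 : ℤ) < m + 1 by omega)
    omega⟩

theorem cyclicProj_val (m : ℕ) (k : ℤ) : (((cyclicProj m k : Fin (m + 1)) : ℕ) : ℤ) =
    k % (m + 1 : ℤ) :=
  Int.toNat_of_nonneg (Int.emod_nonneg k (by omega))

theorem cyclicProj_coe {m : ℕ} (a : Fin (m + 1)) : cyclicProj m a = a := by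
  apply Fin.ext
  have := cyclicProj_val m a
  rw [Int.emod_eq_of_lt (by omega) (by omega)] at this
  exact_mod_cast this

theorem cyclicProj_eq_iff {m : ℕ} {k l : ℤ} :
    cyclicProj m k = cyclicProj m l ↔ ∃ q, k = l + (m + 1 : ℤ) * q := by
  rw [Fin.ext_iff, ← Int.natCast_inj, cyclicProj_val, cyclicProj_val, eq_comm,
    Int.emod_eq_emod_iff_emod_sub_eq_zero, eq_comm, ← Int.dvd_iff_emod_eq_zero.trans eq_comm]
  constructor
  · rintro ⟨q, hq⟩; exact ⟨-q, by linarith⟩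
  · rintro ⟨q, hq⟩; exact ⟨-q, by linarith⟩

variable {n m : ℕ}

theorem cyclicProj_lift (hm : m + 1 = 2 * n) (k : ℤ) :
    ∃ q : ℤ, ((cyclicProj m k : ℕ) : ℤ) = k + 2 * (n * q) := by
  obtain ⟨q, hq⟩ := cyclicProj_eq_iff.1 (cyclicProj_coe (cyclicProj m k))
  have : (m + 1 : ℤ) = 2 * n := by exact_mod_cast hm
  exact ⟨q, by rw [hq, this, mul_assoc]⟩

theorem cyclicProj_add (hm : m + 1 = 2 * n) (k q : ℤ) :
    cyclicProj m (k + 2 * (n * q)) = cyclicProj m k := by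
  have : (m + 1 : ℤ) = 2 * n := by exact_mod_cast hm
  exact cyclicProj_eq_iff.2 ⟨q, by rw [this, mul_assoc]⟩

/-- The quotient of the star frieze by the translations by multiples of `2n`. -/
def cyclicQuotient (hn : 1 ≤ n) (hm : m + 1 = 2 * n) :
    FriezeQuotient (starVector n) (6 * n) (Fin (m + 1)) where
  isFrieze := isFrieze_starVector hn
  proj := cyclicProj m
  lift a := a
  proj_lift := cyclicProj_coe
  proj_neighbour i k := by
    obtain ⟨q, hq⟩ := cyclicProj_lift hm k
    rw [hq, neighbour_add_two_mul, cyclicProj_add hm]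
  cartan_lift k := by
    obtain ⟨q, hq⟩ := cyclicProj_lift hm k
    rw [hq, friezeCartan_add_two_mul (wedge_starVector_add_mul (by omega) q)]
  range_lift k := by
    obtain ⟨q, hq⟩ := cyclicProj_lift hm k
    rw [hq, range_friezeRoot_add_two_mul (wedge_starVector_add_mul (by omega) q)]
  proj_add k ε := by
    -- Here `2N = 12n` is six times the translation length `2n`.
    rw [← cyclicProj_add hm k (6 * ε)]
    congr 1
    push_cast
    ring

theorem cyclicQuotient_isCycleDiagram (hn : 1 ≤ n) (hm : m + 1 = 2 * n) :
    IsCycleDiagram (cyclicQuotient hn hm).scheme.objectChangeDiagram := by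
  set Q := cyclicQuotient hn hm
  have hproj : Q.proj = cyclicProj m := rfl
  have hlab : ∀ {k l : ℤ}, cyclicProj m k = cyclicProj m l → label k = label l := by
    intro k l h
    obtain ⟨q, rfl⟩ := cyclicProj_eq_iff.1 h
    rw [show (m + 1 : ℤ) = 2 * n by exact_mod_cast hm, mul_assoc, label_add_two_mul]
  have hadd : ∀ {k l : ℤ} (t : ℤ), cyclicProj m k = cyclicProj m l →
      cyclicProj m (k + t) = cyclicProj m (l + t) := by
    intro k l t h
    obtain ⟨q, rfl⟩ := cyclicProj_eq_iff.1 h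
    exact cyclicProj_eq_iff.2 ⟨q, by ring⟩
  have hsucc : ∀ k : Fin (m + 1), k + 1 = cyclicProj m (k + 1) := by
    intro k
    apply Fin.ext
    have := cyclicProj_val m (k + 1)
    rw [Fin.val_add]
    -- The case `m = 0` is void because `m + 1 = 2n` is even.
    rcases m.eq_zero_or_pos with rfl | h
    · omega
    · rw [Fin.val_one', Nat.mod_eq_of_lt (show 1 < m + 1 by omega)]
      exact_mod_cast this.symm
  have link : ∀ k : Fin (m + 1), Q.scheme.objectChangeDiagram.IsLink
      (label (k + 1), s(k, k + 1)) k (k + 1) := by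
    intro k
    refine ⟨?_, ?_, rfl⟩
    · intro h
      rw [hsucc] at h
      have := hlab ((cyclicProj_coe k).trans h)
      exact label_add_one_ne _ this.symm
    · have := Q.scheme_ρ_proj (label (k + 1)) k
      rw [neighbour_label_add_one, hproj, cyclicProj_coe, ← hsucc] at this
      exact this
  refine ⟨m, (Equiv.Set.univ _).symm,
    Equiv.ofBijective (fun k => ⟨_, (link k).edge_mem⟩) ⟨?_, ?_⟩, link⟩
  · intro k l h
    rw [Subtype.mk.injEq, Prod.mk.injEq, Sym2.eq_iff] at h
    -- For `n = 1` two edges do join the same two vertices; their labels tell them apart.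
    rcases h.2 with h' | h'
    · exact h'.1
    · have e := h'.1
      rw [hsucc, ← cyclicProj_coe k] at e
      have := hlab e
      rw [← h.1] at this
      exact absurd this.symm (label_add_one_ne _)
  · rintro ⟨⟨i, z⟩, hz⟩
    obtain ⟨a, b, -, hb, rfl⟩ := (Graph.edge_mem_iff_exists_isLink _ _).1 hz
    have hb' := Q.scheme_ρ_proj i a
    rw [hproj, cyclicProj_coe, hb] at hb'
    -- An edge leaving `a` backwards is the one listed at its other end `b`; an edge leaving
    -- forwards is listed at `a`.
    rcases label_eq_or a i with rfl | rfl
    · rw [neighbour_label] at hb'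
      have h := hadd 1 ((cyclicProj_coe b).trans hb')
      rw [sub_add_cancel] at h
      refine ⟨b, Subtype.ext ?_⟩
      change (label (b + 1), s(b, b + 1)) = _
      rw [hsucc, h, cyclicProj_coe, hlab h, Sym2.eq_swap]
    · rw [neighbour_label_add_one, ← hsucc] at hb'
      exact ⟨a, Subtype.ext (congrArg (fun c => (label (a + 1), s(a, c))) hb'.symm)⟩

end Cyclic

/-! ### Dividing also by the reflection: the chain -/

section Folded

/-- The projection of the integers to `{0, …, p}` that folds at both ends. -/
def foldedProj (p : ℕ) (k : ℤ) : Fin (p + 1) :=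
  ⟨(min (k % (2 * (p + 1))) (2 * (p + 1) - 1 - k % (2 * (p + 1)))).toNat, by omega⟩

theorem foldedProj_val (p : ℕ) (k : ℤ) : ((foldedProj p k : ℕ) : ℤ) =
    min (k % (2 * (p + 1))) (2 * (p + 1) - 1 - k % (2 * (p + 1))) := by
  have := Int.emod_nonneg k (show (2 * (p + 1) : ℤ) ≠ 0 by omega)
  have := Int.emod_lt_of_pos k (show (0 : ℤ) < 2 * (p + 1) by omega)
  exact Int.toNat_of_nonneg (by omega)

variable {p : ℕ}

theorem foldedProj_of_lt {k : ℤ} (h0 : 0 ≤ k) (h1 : k < p + 1) :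
    ((foldedProj p k : ℕ) : ℤ) = k := by
  rw [foldedProj_val, Int.emod_eq_of_lt h0 (by omega)]
  omega

theorem foldedProj_coe (a : Fin (p + 1)) : foldedProj p a = a := by
  apply Fin.ext
  exact_mod_cast foldedProj_of_lt (p := p) (k := a) (by omega) (by omega)

theorem foldedProj_add (k q : ℤ) :
    foldedProj p (k + 2 * (((p + 1 : ℕ) : ℤ) * q)) = foldedProj p k := by
  apply Fin.ext
  rw [← Int.natCast_inj, foldedProj_val, foldedProj_val, ← mul_assoc]
  push_cast
  rw [Int.add_mul_emod_self_left]

theorem foldedProj_reflect (k : ℤ) : foldedProj p (-k - 1) = foldedProj p k := by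
  apply Fin.ext
  rw [← Int.natCast_inj, foldedProj_val, foldedProj_val]
  have l := Int.emod_nonneg k (show (2 * (p + 1) : ℤ) ≠ 0 by omega)
  have u := Int.emod_lt_of_pos k (show (0 : ℤ) < 2 * (p + 1) by omega)
  have e := Int.emod_add_mul_ediv k (2 * (p + 1))
  have : (-k - 1) % (2 * (p + 1) : ℤ) = 2 * (p + 1) - 1 - k % (2 * (p + 1)) := by
    rw [← Int.emod_eq_of_lt (a := 2 * (p + 1) - 1 - k % (2 * (p + 1) : ℤ)) (by omega)
      (show _ < (2 * (p + 1) : ℤ) by omega)]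
    have e' : -k - 1 = 2 * (p + 1) - 1 - k % (2 * (p + 1)) +
        2 * (p + 1) * (-(k / (2 * (p + 1))) - 1) := by linarith
    rw [e', Int.add_mul_emod_self_left]
  rw [this]
  omega

/-- The two values competing in the minimum are the representatives of `k` modulo translations and
of its mirror image `-k - 1`. -/
theorem foldedProj_lift (k : ℤ) : ∃ q : ℤ,
    ((foldedProj p k : ℕ) : ℤ) = k + 2 * (((p + 1 : ℕ) : ℤ) * q) ∨
    ((foldedProj p k : ℕ) : ℤ) = -k - 1 + 2 * (((p + 1 : ℕ) : ℤ) * q) := by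
  have e := Int.emod_add_mul_ediv k (2 * (p + 1))
  rw [foldedProj_val]
  push_cast
  rcases min_choice (k % (2 * (p + 1))) (2 * (p + 1) - 1 - k % (2 * (p + 1)) : ℤ) with h | h
  · exact ⟨-(k / (2 * (p + 1))), Or.inl (by rw [h]; linarith)⟩
  · exact ⟨k / (2 * (p + 1)) + 1, Or.inr (by rw [h]; linarith)⟩

/-- The quotient of the star frieze by the translations by multiples of `2n` and the
reflections, where `n = p + 1`. -/
def foldedQuotient (p : ℕ) :
    FriezeQuotient (starVector (p + 1 : ℕ)) (6 * (p + 1)) (Fin (p + 1)) where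
  isFrieze := isFrieze_starVector (by omega)
  proj := foldedProj p
  lift a := a
  proj_lift := foldedProj_coe
  proj_neighbour i k := by
    obtain ⟨q, hq | hq⟩ := foldedProj_lift (p := p) k
    · rw [hq, neighbour_add_two_mul, foldedProj_add]
    · rw [hq, neighbour_add_two_mul, foldedProj_add, neighbour_reflect, foldedProj_reflect]
  cartan_lift k := by
    have hp : (0 : ℤ) < (p + 1 : ℕ) := by omega
    obtain ⟨q, hq | hq⟩ := foldedProj_lift (p := p) k
    · rw [hq, friezeCartan_add_two_mul (wedge_starVector_add_mul hp q)]
    · rw [hq, friezeCartan_add_two_mul (wedge_starVector_add_mul hp q),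
        friezeCartan_reflect (wedge_starVector_neg hp)]
  range_lift k := by
    have hp : (0 : ℤ) < (p + 1 : ℕ) := by omega
    obtain ⟨q, hq | hq⟩ := foldedProj_lift (p := p) k
    · rw [hq, range_friezeRoot_add_two_mul (wedge_starVector_add_mul hp q)]
    · rw [hq, range_friezeRoot_add_two_mul (wedge_starVector_add_mul hp q),
        range_friezeRoot_reflect (isFrieze_starVector (by omega)) (wedge_starVector_neg hp)]
  proj_add k ε := by
    rw [← foldedProj_add k (6 * ε)]
    congr 1
    push_cast
    ring

theorem foldedQuotient_isChainDiagram (p : ℕ) :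
    IsChainDiagram (foldedQuotient p).scheme.objectChangeDiagram := by
  set Q := foldedQuotient p
  have hproj : Q.proj = foldedProj p := rfl
  have hval : ∀ {k : ℤ} {a : Fin (p + 1)}, (a : ℤ) = k → foldedProj p k = a := by
    rintro _ a rfl
    exact foldedProj_coe a
  have link : ∀ k : Fin p, Q.scheme.objectChangeDiagram.IsLink
      (label (k + 1), s(k.castSucc, k.succ)) k.castSucc k.succ := by
    intro k
    refine ⟨k.castSucc_lt_succ.ne, ?_, rfl⟩
    have := Q.scheme_ρ_proj (label (k + 1)) k
    rw [neighbour_label_add_one, hproj, hval (k := k) (a := k.castSucc) (by simp),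
      hval (a := k.succ) (by simp)] at this
    exact this
  refine ⟨p, (Equiv.Set.univ _).symm,
    Equiv.ofBijective (fun k => ⟨_, (link k).edge_mem⟩) ⟨?_, ?_⟩, link⟩
  · intro k l h
    rw [Subtype.mk.injEq, Prod.mk.injEq, Sym2.eq_iff] at h
    simp only [Fin.ext_iff, Fin.val_castSucc, Fin.val_succ] at h
    omega
  · rintro ⟨⟨i, z⟩, hz⟩
    obtain ⟨a, b, hab, hb, rfl⟩ := (Graph.edge_mem_iff_exists_isLink _ _).1 hz
    have hb' := Q.scheme_ρ_proj i a
    rw [hproj, foldedProj_coe, hb] at hb'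
    rcases label_eq_or a i with rfl | rfl
    · rw [neighbour_label] at hb'
      -- At the left end the step back leads to `-1`, which folds onto `0`: a fixed point of the
      -- involution, hence no edge.
      by_cases h0 : (a : ℕ) = 0
      · refine absurd ?_ hab
        rw [hb', ← foldedProj_reflect, show -((a : ℤ) - 1) - 1 = a by omega, foldedProj_coe]
      · have hbv := foldedProj_of_lt (p := p) (k := a - 1) (by omega) (by omega)
        rw [← hb'] at hbv
        refine ⟨⟨b, by omega⟩, Subtype.ext ?_⟩
        change (label (b + 1), _) = (_, s(a, b))
        rw [hbv, sub_add_cancel, Sym2.eq_swap]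
        congr 2
        exact Fin.ext (by simp; omega)
    · rw [neighbour_label_add_one] at hb'
      -- At the right end the step forward leads to `p + 1`, which folds onto `p`.
      by_cases h0 : (a : ℕ) = p
      · refine absurd ?_ hab
        rw [hb', ← foldedProj_reflect, ← foldedProj_add _ 1,
          show -((a : ℤ) + 1) - 1 + 2 * (((p + 1 : ℕ) : ℤ) * 1) = a by push_cast; omega,
          foldedProj_coe]
      · have hbv := foldedProj_of_lt (p := p) (k := a + 1) (by omega) (by omega)
        rw [← hb'] at hbv
        refine ⟨⟨a, by omega⟩, Subtype.ext ?_⟩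
        change (label (a + 1), _) = (_, s(a, b))
        congr 2
        exact Fin.ext (by simp; omega)

end Folded

theorem mainTheorem8 (n : ℕ) (hn : 1 ≤ n) :
    (∃ (A : Type) (C : CartanScheme (Fin 2) A) (R : C.RootSys),
      Finite A ∧ Nat.card A = 2 * n ∧ C.IsConnected ∧ R.IsFinite ∧ R.IsIrreducible ∧
      (∀ a, IsIndecomposableCartanMatrix (C.cartan a)) ∧
      IsCycleDiagram C.objectChangeDiagram ∧
      ∃ a i j, C.cartan a i j = -(2 * (n : ℤ) + 1)) ∧
    (∃ (A : Type) (C : CartanScheme (Fin 2) A) (R : C.RootSys),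
      Finite A ∧ Nat.card A = n ∧ C.IsConnected ∧ R.IsFinite ∧ R.IsIrreducible ∧
      (∀ a, IsIndecomposableCartanMatrix (C.cartan a)) ∧
      IsChainDiagram C.objectChangeDiagram ∧
      ∃ a i j, C.cartan a i j = -(2 * (n : ℤ) + 1)) := by
  -- The extreme Cartan entry occurs at the object of `0`, the vertex of the polygon where `2n + 1`
  -- triangles meet.
  have hc := wedge_starVector_neg_one (n := n) (by omega)
  constructor
  · obtain ⟨m, hm⟩ : ∃ m, m + 1 = 2 * n := ⟨2 * n - 1, by omega⟩
    let Q := cyclicQuotient hn hm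
    exact ⟨Fin (m + 1), Q.scheme, Q.rootSys, inferInstance, by simp [hm], Q.isConnected,
      Q.isFinite, Q.isIrreducible, Q.isIndecomposable, cyclicQuotient_isCycleDiagram hn hm,
      hc ▸ Q.exists_cartan_eq 0⟩
  · obtain ⟨p, rfl⟩ : ∃ p, n = p + 1 := ⟨n - 1, by omega⟩
    let Q := foldedQuotient p
    exact ⟨Fin (p + 1), Q.scheme, Q.rootSys, inferInstance, by simp, Q.isConnected,
      Q.isFinite, Q.isIrreducible, Q.isIndecomposable, foldedQuotient_isChainDiagram p,
      hc ▸ Q.exists_cartan_eq 0⟩
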